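/- Let $N\ge 1$, $K\ge 0$ be integers and $\rho\ge 0$. Consider $N$ queues of capacity $K$. Customers arrive according to a Poisson process of rate $\rho N$; each arriving customer draws two queues independently and uniformly at random among the $N$ queues and goes to the one that has fewer customers, ties being broken by a fair coin. The customer is lost if that queue already holds $K$ customers. Each queue has one server, and the service times are exponential with mean $1$; interarrival times, service times and choices are independent. Thus the vector $L(t)\in\{0,\dots,K\}^N$ of queue lengths is the continuous-time Markov process in which, in state $x$, queue $i$ receives an arriving customer at rate $\rho N\,p_i(x)$, where $p_i(x)$ is the probability that the above rule selects queue $i$ (with no effect if $x_i=K$), and each nonempty queue loses a customer at rate $1$. Let $V^{N,\rho}_k(t)$ be the proportion of queues that hold at least $k$ customers at time $t$, and $V^{N,\rho}(t)=(V^{N,\rho}_k(t))_{k\ge 0}$. For random elements of a partially ordered space, $X\le_{st}Y$ means $\mathbb P(X\in A)\le\mathbb P(Y\in A)$ for every measurable up-closed set $A$; for real random variables this is $\mathbb P(X>a)\le\mathbb P(Y>a)$ for all $a\in\mathbb R$. **Proposition.** Let $0\le\rho\le\rho'$, and suppose that the two systems with parameters $\rho$ and $\rho'$ have ordered initial conditions,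 $V^{N,\rho}(0)\le_{st}V^{N,\rho'}(0)$ for the componentwise order (for instance, the same initial distribution). Then for every $k$ and every $t>0$, $$V^{N,\rho}_k(t)\le_{st}V^{N,\rho'}_k(t).$$ -/

import Mathlib

open MeasureTheory
open scoped NNReal

namespace TwoChoice

/-- Configurations of `N` queues of capacity `K`: `x i` is the number of customers in queue `i`. -/
abbrev Config (N K : ℕ) : Type := Fin N → Fin (K + 1)

/-- A customer joins queue `i`; the customer is lost (nothing changes) if queue `i` is full. -/
def arrive {N K : ℕ} (x : Config N K) (i : Fin N) : Config N K :=
  Function.update x i ⟨min ((x i : ℕ) + 1) K, by omega⟩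

/-- A service completion in queue `i`; nothing changes if queue `i` is empty
(the natural-number subtraction truncates at `0`). -/
def depart {N K : ℕ} (x : Config N K) (i : Fin N) : Config N K :=
  Function.update x i ⟨(x i : ℕ) - 1, by omega⟩

/-- The probability that a customer who has drawn the queues `a` and `b` goes to queue `i`: the
least loaded of the two is selected, and a tie is broken by a fair coin. -/
noncomputable def selectProb {N K : ℕ} (x : Config N K) (a b i : Fin N) : ℝ :=
  if x a < x b then (if i = a then 1 else 0)
  else if x b < x a then (if i = b then 1 else 0)
  else ((if i = a then 1 else 0) + (if i = b then 1 else 0)) / 2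

/-- The probability that an arriving customer, who draws two queues independently and uniformly
among the `N` queues, goes to queue `i`. -/
noncomputable def joinProb {N K : ℕ} (x : Config N K) (i : Fin N) : ℝ :=
  (∑ a : Fin N, ∑ b : Fin N, selectProb x a b i) / (N : ℝ) ^ 2

/-- The `Q`-matrix of the configuration process: customers arrive at total rate `ρ N`, and each
nonempty queue serves at rate `1`. An event of rate `r` leading from `x` to `z` contributes `r` to
the entry `(x, z)` and `-r` to the diagonal entry `(x, x)`; thus an event that changes nothing
contributes nothing. -/
noncomputable def generator (N K : ℕ) (ρ : ℝ) : Matrix (Config N K) (Config N K) ℝ :=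
  fun x y =>
    (∑ i : Fin N, ρ * N * joinProb x i *
      ((if arrive x i = y then 1 else 0) - (if x = y then 1 else 0)))
    + ∑ i : Fin N, ((if depart x i = y then 1 else 0) - (if x = y then 1 else 0))

/-- `X` is a time-homogeneous continuous-time Markov process on the finite set `E` with
`Q`-matrix `Q`: its finite-dimensional distributions are those of the transition semigroup
`t ↦ exp (t Q)`, with an arbitrary initial distribution. -/
structure IsMarkovProcess {Ω E : Type*} [MeasurableSpace Ω] [Fintype E] [DecidableEq E]
    [MeasurableSpace E] (P : Measure Ω) (Q : Matrix E E ℝ) (X : ℝ≥0 → Ω → E) : Prop where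
  measurable : ∀ t, Measurable (X t)
  fdd : ∀ (n : ℕ) (t : Fin (n + 1) → ℝ≥0), Monotone t → ∀ x : Fin (n + 1) → E,
    P.real {ω | ∀ j, X (t j) ω = x j} =
      P.real {ω | X (t 0) ω = x 0} *
        ∏ j : Fin n, NormedSpace.exp (((t j.succ : ℝ) - (t j.castSucc : ℝ)) • Q)
          (x j.castSucc) (x j.succ)

/-- `L` is the vector of queue lengths of a join-the-shortest-of-two-queues system with `N` queues
of capacity `K`, Poisson arrivals of rate `ρ N` and exponential services of mean `1`. -/
def IsTwoChoiceSystem {Ω : Type*} [MeasurableSpace Ω] (P : Measure Ω) (N K : ℕ) (ρ : ℝ)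
    (L : ℝ≥0 → Ω → Config N K) : Prop :=
  IsMarkovProcess P (generator N K ρ) L

/-- The proportion of queues with at least `k` customers. -/
noncomputable def proportion {N K : ℕ} (x : Config N K) (k : ℕ) : ℝ :=
  ((Finset.univ.filter fun i : Fin N => k ≤ (x i : ℕ)).card : ℝ) / N

/-- The usual stochastic order `X ≤_st Y` between random elements of a preordered space, which may
live on different probability spaces. For real random variables this says that
`P (X > a) ≤ P' (Y > a)` for all real `a`. -/
def StochLE {Ω Ω' E : Type*} [MeasurableSpace Ω] [MeasurableSpace Ω'] [MeasurableSpace E]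
    [Preorder E] (P : Measure Ω) (P' : Measure Ω') (X : Ω → E) (Y : Ω' → E) : Prop :=
  ∀ A : Set E, MeasurableSet A → IsUpperSet A → P (X ⁻¹' A) ≤ P' (Y ⁻¹' A)

end TwoChoice

/-!
Compare two configurations by their vectors of proportions: `x` lies below `y` when
`proportion x ≤ proportion y`. If both are sorted, this is the pointwise order
(`le_of_proportion_le`). The two-choice rule applied to a sorted configuration selects the queue of
rank `min a b`, where `a` and `b` are the ranks drawn, whatever the configuration is. Arrivals and
departures at a fixed rank preserve the pointwise order, so the operators "expectation after an
arrival" and "sum over the departures" preserve the class of functions that are monotone for the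
comparison of proportions (`PropMono.arrivalMean`, `PropMono.sum_depart`); here such functions are
invariant under permutations of the queues, which is what allows the sorting.

By uniformization, `exp (t Q) = exp (-c t) exp (t (Q + c))`, and for `c` large `Q + c` is a
combination with nonnegative coefficients of these two operators and of the identity. Its powers,
and hence the semigroup, preserve the monotone functions. As an arrival can only increase a monotone
function, the powers for `ρ` are bounded by the powers for `ρ'` on such functions
(`uniformized_pow_mulVec`), and so are the semigroups (`PropMono.exp_generator`,
`PropMono.exp_generator_le`). The initial laws are compared on monotone functions by
the layer cake formula (`StochLE.integral_le`).
-/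

namespace TwoChoice

open Matrix

variable {N K : ℕ}

/-! ### The order given by the proportions -/

/-- `f` is monotone for the comparison of configurations through their vectors of proportions. Such
a function is invariant under permutations of the queues. -/
def PropMono (f : Config N K → ℝ) : Prop :=
  ∀ x y : Config N K, proportion x ≤ proportion y → f x ≤ f y

lemma proportion_le_of_le {x y : Config N K} (h : x ≤ y) : proportion x ≤ proportion y := by
  intro k
  unfold proportion
  gcongr
  exact h _

lemma proportion_comp_perm (x : Config N K) (σ : Equiv.Perm (Fin N)) :
    proportion (x ∘ σ) = proportion x := by
  funext k
  unfold proportion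
  congr 2
  refine Finset.card_bij (fun i _ => σ i) (by simp) (fun a _ b _ h => σ.injective h) ?_
  intro b hb
  exact ⟨σ.symm b, by simpa using hb, by simp⟩

/-- For sorted configurations, the comparison of proportions is the pointwise order. -/
lemma le_of_proportion_le {x y : Config N K} (hx : Monotone x) (hy : Monotone y)
    (h : proportion x ≤ proportion y) : x ≤ y := by
  intro i
  by_contra! hlt
  have hN : (0 : ℝ) < N := by exact_mod_cast i.pos
  have h1 := h (x i : ℕ)
  unfold proportion at h1
  rw [div_le_div_iff_of_pos_right hN, Nat.cast_le] at h1
  -- All queues of rank at least `i` count for `x`, only those of rank above `i` can count for `y`.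
  have h2 : Finset.Ici i ⊆ Finset.univ.filter fun j : Fin N => (x i : ℕ) ≤ (x j : ℕ) := by
    intro j hj
    simpa using hx (Finset.mem_Ici.1 hj)
  have h3 : (Finset.univ.filter fun j : Fin N => (x i : ℕ) ≤ (y j : ℕ)) ⊆ Finset.Ioi i := by
    intro j hj
    rw [Finset.mem_Ioi]
    by_contra! hji
    have h4 : x i ≤ y j := by simpa using hj
    exact absurd (h4.trans (hy hji)) (not_le.2 hlt)
  have h5 : (Finset.Ioi i).card < (Finset.Ici i).card :=
    Finset.card_lt_card (Finset.ssubset_iff_of_subset Finset.Ioi_subset_Ici_self |>.2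
      ⟨i, by simp, by simp⟩)
  have := Finset.card_le_card h2
  have := Finset.card_le_card h3
  omega

lemma PropMono.congr {f : Config N K → ℝ} (hf : PropMono f) {x y : Config N K}
    (h : proportion x = proportion y) : f x = f y :=
  le_antisymm (hf _ _ h.le) (hf _ _ h.ge)

/-- A permutation-invariant function that is monotone for the pointwise order on sorted
configurations is monotone for the comparison of proportions. -/
lemma PropMono.of_sorted {f : Config N K → ℝ}
    (hperm : ∀ x (σ : Equiv.Perm (Fin N)), f (x ∘ σ) = f x)
    (hmono : ∀ x y : Config N K, Monotone x → Monotone y → x ≤ y → f x ≤ f y) : PropMono f := by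
  intro x y h
  rw [← hperm x (Tuple.sort x), ← hperm y (Tuple.sort y)]
  have hx := Tuple.monotone_sort x
  have hy := Tuple.monotone_sort y
  refine hmono _ _ hx hy (le_of_proportion_le hx hy ?_)
  rwa [proportion_comp_perm, proportion_comp_perm]

/-! ### Arrivals and departures -/

lemma arrive_comp_perm (x : Config N K) (σ : Equiv.Perm (Fin N)) (i : Fin N) :
    arrive (x ∘ σ) i = arrive x (σ i) ∘ σ := by
  unfold arrive
  funext j
  by_cases h : j = i
  · subst h; simp
  · simp [h]

lemma depart_comp_perm (x : Config N K) (σ : Equiv.Perm (Fin N)) (i : Fin N) :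
    depart (x ∘ σ) i = depart x (σ i) ∘ σ := by
  unfold depart
  funext j
  by_cases h : j = i
  · subst h; simp
  · simp [h]

lemma arrive_le_arrive {x y : Config N K} (h : x ≤ y) (i : Fin N) : arrive x i ≤ arrive y i := by
  refine update_le_update_iff.2 ⟨?_, fun j _ => h j⟩
  have := Fin.le_def.1 (h i)
  rw [Fin.mk_le_mk]
  omega

lemma depart_le_depart {x y : Config N K} (h : x ≤ y) (i : Fin N) : depart x i ≤ depart y i := by
  refine update_le_update_iff.2 ⟨?_, fun j _ => h j⟩
  have := Fin.le_def.1 (h i)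
  rw [Fin.mk_le_mk]
  omega

lemma le_arrive (x : Config N K) (i : Fin N) : x ≤ arrive x i := by
  refine le_update_iff.2 ⟨?_, fun j _ => le_rfl⟩
  rw [Fin.le_def]
  have := (x i).is_le
  simp only
  omega

/-- Joining one of two equally loaded queues or the other gives the same proportions. -/
lemma proportion_arrive_of_eq {x : Config N K} {a b : Fin N} (h : x a = x b) :
    proportion (arrive x a) = proportion (arrive x b) := by
  have hx : x ∘ Equiv.swap a b = x := by
    funext j
    simp only [Function.comp_apply, Equiv.swap_apply_def]
    split_ifs with h1 h2
    · rw [h1, h]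
    · rw [h2, h]
    · rfl
  have h1 := arrive_comp_perm x (Equiv.swap a b) a
  rw [hx, Equiv.swap_apply_left] at h1
  rw [h1, proportion_comp_perm]

/-- The expectation of `f` after the arrival of a customer in state `x`. -/
noncomputable def arrivalMean (f : Config N K → ℝ) (x : Config N K) : ℝ :=
  ∑ i, joinProb x i * f (arrive x i)

lemma joinProb_nonneg (x : Config N K) (i : Fin N) : 0 ≤ joinProb x i := by
  unfold joinProb
  refine div_nonneg (Finset.sum_nonneg fun a _ => Finset.sum_nonneg fun b _ => ?_) (by positivity)
  unfold selectProb
  split_ifs <;> norm_num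

lemma sum_selectProb_mul (x : Config N K) (a b : Fin N) (g : Fin N → ℝ) :
    ∑ i, selectProb x a b i * g i =
      if x a < x b then g a else if x b < x a then g b else (g a + g b) / 2 := by
  unfold selectProb
  split_ifs
  · simp
  · simp
  · simp [div_mul_eq_mul_div, add_mul, ← Finset.sum_div, Finset.sum_add_distrib]

lemma sum_joinProb_mul (x : Config N K) (g : Fin N → ℝ) :
    ∑ i, joinProb x i * g i =
      (∑ a, ∑ b, if x a < x b then g a else if x b < x a then g b else (g a + g b) / 2)
        / (N : ℝ) ^ 2 := by
  simp only [← sum_selectProb_mul, joinProb, div_mul_eq_mul_div, ← Finset.sum_div, Finset.sum_mul]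
  congr 1
  rw [Finset.sum_comm]
  exact Finset.sum_congr rfl fun a _ => Finset.sum_comm

lemma sum_joinProb (hN : 1 ≤ N) (x : Config N K) : ∑ i, joinProb x i = 1 := by
  have h := sum_joinProb_mul x (fun _ => 1)
  have hN' : (N : ℝ) ≠ 0 := by positivity
  simp only [mul_one] at h
  rw [h]
  norm_num
  field_simp

lemma arrivalMean_comp_perm {f : Config N K → ℝ} (hf : PropMono f) (x : Config N K)
    (σ : Equiv.Perm (Fin N)) : arrivalMean f (x ∘ σ) = arrivalMean f x := by
  unfold arrivalMean
  rw [sum_joinProb_mul, sum_joinProb_mul]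
  congr 1
  have h : ∀ i, f (arrive (x ∘ σ) i) = f (arrive x (σ i)) := fun i =>
    hf.congr (by rw [arrive_comp_perm, proportion_comp_perm])
  simp only [h, Function.comp_apply]
  refine Eq.trans (Finset.sum_congr rfl fun a _ => Equiv.sum_comp σ
    (fun b => if x (σ a) < x b then f (arrive x (σ a)) else
      if x b < x (σ a) then f (arrive x b) else (f (arrive x (σ a)) + f (arrive x b)) / 2)) ?_
  exact Equiv.sum_comp σ fun a => ∑ b, if x a < x b then f (arrive x a) else
    if x b < x a then f (arrive x b) else (f (arrive x a) + f (arrive x b)) / 2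

/-- In a sorted configuration the customer may be assumed to join the queue of rank `min a b`: for
the proportions, ties do not matter. -/
lemma arrivalMean_of_monotone {f : Config N K → ℝ} (hf : PropMono f) {x : Config N K}
    (hx : Monotone x) :
    arrivalMean f x = (∑ a, ∑ b, f (arrive x (min a b))) / (N : ℝ) ^ 2 := by
  unfold arrivalMean
  rw [sum_joinProb_mul]
  congr 1
  refine Finset.sum_congr rfl fun a _ => Finset.sum_congr rfl fun b _ => ?_
  split_ifs with h1 h2
  · rw [min_eq_left (hx.reflect_lt h1).le]
  · rw [min_eq_right (hx.reflect_lt h2).le]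
  · have h := hf.congr (proportion_arrive_of_eq (le_antisymm (not_lt.1 h2) (not_lt.1 h1)))
    rcases min_choice a b with h3 | h3 <;> rw [h3, h] <;> ring

lemma PropMono.arrivalMean {f : Config N K → ℝ} (hf : PropMono f) :
    PropMono (arrivalMean f) := by
  refine .of_sorted (arrivalMean_comp_perm hf) fun x y hx hy h => ?_
  rw [arrivalMean_of_monotone hf hx, arrivalMean_of_monotone hf hy]
  gcongr with a _ b _
  exact hf _ _ (proportion_le_of_le (arrive_le_arrive h _))

lemma PropMono.sum_depart {f : Config N K → ℝ} (hf : PropMono f) :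
    PropMono (fun x => ∑ i, f (depart x i)) := by
  refine .of_sorted (fun x σ => ?_) fun x y _ _ h => Finset.sum_le_sum fun i _ =>
    hf _ _ (proportion_le_of_le (depart_le_depart h i))
  have h : ∀ i, f (depart (x ∘ σ) i) = f (depart x (σ i)) := fun i =>
    hf.congr (by rw [depart_comp_perm, proportion_comp_perm])
  simp only [h]
  exact Equiv.sum_comp σ fun i => f (depart x i)

lemma PropMono.le_arrivalMean (hN : 1 ≤ N) {f : Config N K → ℝ} (hf : PropMono f)
    (x : Config N K) : f x ≤ TwoChoice.arrivalMean f x := by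
  calc f x = ∑ i, joinProb x i * f x := by rw [← Finset.sum_mul, sum_joinProb hN, one_mul]
    _ ≤ _ := Finset.sum_le_sum fun i _ => mul_le_mul_of_nonneg_left
        (hf _ _ (proportion_le_of_le (le_arrive x i))) (joinProb_nonneg x i)

/-! ### Uniformization -/

lemma generator_mulVec (hN : 1 ≤ N) (ρ : ℝ) (f : Config N K → ℝ) (x : Config N K) :
    (generator N K ρ *ᵥ f) x =
      ρ * N * (arrivalMean f x - f x) + (∑ i, f (depart x i) - N * f x) := by
  have h (z : Config N K) :
      ∑ y, ((if z = y then (1 : ℝ) else 0) - (if x = y then 1 else 0)) * f y = f z - f x := by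
    simp [sub_mul, Finset.sum_sub_distrib]
  simp only [mulVec, dotProduct, generator, add_mul, Finset.sum_add_distrib, Finset.sum_mul]
  rw [Finset.sum_comm]
  conv_lhs => rw [Finset.sum_comm (s := Finset.univ (α := Config N K)) (t := Finset.univ)]
  simp only [mul_assoc, ← Finset.mul_sum, h]
  simp only [mul_sub, Finset.sum_sub_distrib, ← Finset.sum_mul, sum_joinProb hN, arrivalMean]
  simp

/-- The `Q`-matrix shifted by the multiple `c` of the identity. -/
noncomputable def uniformized (N K : ℕ) (ρ c : ℝ) : Matrix (Config N K) (Config N K) ℝ :=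
  generator N K ρ + c • 1

lemma uniformized_mulVec (hN : 1 ≤ N) (ρ c : ℝ) (f : Config N K → ℝ) (x : Config N K) :
    (uniformized N K ρ c *ᵥ f) x =
      ρ * N * arrivalMean f x + ∑ i, f (depart x i) + (c - (ρ + 1) * N) * f x := by
  simp only [uniformized, add_mulVec, Pi.add_apply, generator_mulVec hN, smul_mulVec, one_mulVec,
    Pi.smul_apply, smul_eq_mul]
  ring

lemma PropMono.uniformized_mulVec (hN : 1 ≤ N) {ρ c : ℝ} (hρ : 0 ≤ ρ) (hc : (ρ + 1) * N ≤ c)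
    {f : Config N K → ℝ} (hf : PropMono f) : PropMono (uniformized N K ρ c *ᵥ f) := by
  intro x y h
  rw [TwoChoice.uniformized_mulVec hN, TwoChoice.uniformized_mulVec hN]
  have h1 := mul_le_mul_of_nonneg_left (hf.arrivalMean x y h) (by positivity : 0 ≤ ρ * N)
  have h2 := hf.sum_depart x y h
  have h3 := mul_le_mul_of_nonneg_left (hf x y h) (sub_nonneg.2 hc)
  simp only at h2
  linarith

/-- The shifted `Q`-matrix is increasing in `ρ` on monotone functions, since an arrival can
only increase them, and acts monotonically on functions as its entries are nonnegative. -/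
lemma uniformized_mulVec_le (hN : 1 ≤ N) {ρ ρ' c : ℝ} (hρ : 0 ≤ ρ) (hρρ' : ρ ≤ ρ')
    (hc : (ρ' + 1) * N ≤ c) {f g : Config N K → ℝ} (hf : PropMono f) (hfg : f ≤ g) :
    uniformized N K ρ c *ᵥ f ≤ uniformized N K ρ' c *ᵥ g := by
  intro x
  rw [uniformized_mulVec hN, uniformized_mulVec hN]
  have h1 : arrivalMean f x ≤ arrivalMean g x := Finset.sum_le_sum fun i _ =>
    mul_le_mul_of_nonneg_left (hfg _) (joinProb_nonneg x i)
  have h2 : ∑ i, f (depart x i) ≤ ∑ i, g (depart x i) := Finset.sum_le_sum fun i _ => hfg _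
  have h3 := mul_le_mul_of_nonneg_left (hfg x) (sub_nonneg.2 hc)
  have h4 := mul_le_mul_of_nonneg_left (hf.le_arrivalMean hN x)
    (mul_nonneg (sub_nonneg.2 hρρ') (Nat.cast_nonneg N))
  have h5 := mul_le_mul_of_nonneg_left h1
    (mul_nonneg (hρ.trans hρρ') (Nat.cast_nonneg (α := ℝ) N))
  linarith

lemma uniformized_pow_mulVec (hN : 1 ≤ N) {ρ ρ' c : ℝ} (hρ : 0 ≤ ρ) (hρρ' : ρ ≤ ρ')
    (hc : (ρ' + 1) * N ≤ c) {f : Config N K → ℝ} (hf : PropMono f) (n : ℕ) :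
    PropMono (uniformized N K ρ c ^ n *ᵥ f) ∧
      uniformized N K ρ c ^ n *ᵥ f ≤ uniformized N K ρ' c ^ n *ᵥ f := by
  induction n with
  | zero => simpa using hf
  | succ n ih =>
    have hc' : (ρ + 1) * N ≤ c := le_trans (by gcongr) hc
    simp only [pow_succ', ← mulVec_mulVec]
    exact ⟨ih.1.uniformized_mulVec hN hρ hc', uniformized_mulVec_le hN hρ hρρ' hc ih.1 ih.2⟩

lemma hasSum_exp_smul_mulVec {E : Type*} [Fintype E] [DecidableEq E] (M : Matrix E E ℝ) (t : ℝ)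
    (f : E → ℝ) (x : E) :
    HasSum (fun n : ℕ => (n.factorial : ℝ)⁻¹ * t ^ n * (M ^ n *ᵥ f) x)
      ((NormedSpace.exp (t • M) *ᵥ f) x) := by
  -- Any complete algebra norm inducing the product topology will do.
  let _ : NormedRing (Matrix E E ℝ) := Matrix.linftyOpNormedRing
  let _ : NormedAlgebra ℝ (Matrix E E ℝ) := Matrix.linftyOpNormedAlgebra
  have h := NormedSpace.exp_series_hasSum_exp' (𝕂 := ℝ) (t • M)
  have h1 : Continuous fun B : Matrix E E ℝ => (B *ᵥ f) x := by
    simp only [mulVec, dotProduct]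
    fun_prop
  have h2 := h.map (⟨⟨fun B : Matrix E E ℝ => (B *ᵥ f) x, by simp⟩,
    fun A B => by simp [add_mulVec]⟩ : Matrix E E ℝ →+ ℝ) h1
  refine h2.congr_fun ?_
  intro n
  simp [smul_pow, smul_mulVec, mul_assoc]

/-- Uniformization: a shift of the `Q`-matrix by `c` multiplies the semigroup by `exp (t c)`. -/
lemma exp_generator_eq (ρ c t : ℝ) :
    NormedSpace.exp (t • generator N K ρ) =
      Real.exp (-(t * c)) • NormedSpace.exp (t • uniformized N K ρ c) := by
  have h : t • generator N K ρ = algebraMap ℝ _ (-(t * c)) + t • uniformized N K ρ c := by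
    rw [uniformized, smul_add, Algebra.algebraMap_eq_smul_one, smul_smul]
    module
  let _ : NormedRing (Matrix (Config N K) (Config N K) ℝ) := Matrix.linftyOpNormedRing
  let _ : NormedAlgebra ℝ (Matrix (Config N K) (Config N K) ℝ) := Matrix.linftyOpNormedAlgebra
  rw [h, Matrix.exp_add_of_commute _ _ (Algebra.commute_algebraMap_left _ _), Real.exp_eq_exp_ℝ,
    Algebra.smul_def (NormedSpace.exp (-(t * c)))]
  exact congrArg (· * NormedSpace.exp (t • uniformized N K ρ c))
    (NormedSpace.algebraMap_exp_comm (𝕂 := ℝ) (𝔸 := Matrix (Config N K) (Config N K) ℝ)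
      (-(t * c))).symm

lemma PropMono.exp_generator (hN : 1 ≤ N) {ρ t : ℝ} (hρ : 0 ≤ ρ) (ht : 0 ≤ t)
    {f : Config N K → ℝ} (hf : PropMono f) :
    PropMono (NormedSpace.exp (t • generator N K ρ) *ᵥ f) := by
  intro x y h
  rw [exp_generator_eq ρ ((ρ + 1) * N), smul_mulVec]
  refine mul_le_mul_of_nonneg_left (hasSum_le (fun n => ?_) (hasSum_exp_smul_mulVec _ t f x)
    (hasSum_exp_smul_mulVec _ t f y)) (Real.exp_nonneg _)
  exact mul_le_mul_of_nonneg_left ((uniformized_pow_mulVec hN hρ le_rfl le_rfl hf n).1 x y h)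
    (by positivity)

lemma PropMono.exp_generator_le (hN : 1 ≤ N) {ρ ρ' t : ℝ} (hρ : 0 ≤ ρ) (hρρ' : ρ ≤ ρ')
    (ht : 0 ≤ t) {f : Config N K → ℝ} (hf : PropMono f) :
    NormedSpace.exp (t • generator N K ρ) *ᵥ f ≤ NormedSpace.exp (t • generator N K ρ') *ᵥ f := by
  intro x
  rw [exp_generator_eq ρ ((ρ' + 1) * N), exp_generator_eq ρ' ((ρ' + 1) * N), smul_mulVec,
    smul_mulVec]
  refine mul_le_mul_of_nonneg_left (hasSum_le (fun n => ?_) (hasSum_exp_smul_mulVec _ t f x)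
    (hasSum_exp_smul_mulVec _ t f x)) (Real.exp_nonneg _)
  exact mul_le_mul_of_nonneg_left ((uniformized_pow_mulVec hN hρ hρρ' le_rfl hf n).2 x)
    (by positivity)

lemma exp_generator_mulVec_nonneg (hN : 1 ≤ N) {ρ t : ℝ} (hρ : 0 ≤ ρ) (ht : 0 ≤ t)
    {f : Config N K → ℝ} (hf0 : 0 ≤ f) :
    0 ≤ NormedSpace.exp (t • generator N K ρ) *ᵥ f := by
  intro x
  have hpow (n : ℕ) : 0 ≤ uniformized N K ρ ((ρ + 1) * N) ^ n *ᵥ f := by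
    induction n with
    | zero => simpa using hf0
    | succ n ih =>
      rw [pow_succ', ← mulVec_mulVec]
      -- The zero function is monotone and mapped to itself.
      refine le_of_eq_of_le (mulVec_zero (uniformized N K ρ ((ρ + 1) * N))).symm ?_
      exact uniformized_mulVec_le hN hρ le_rfl le_rfl (fun _ _ _ => le_rfl) ih
  rw [exp_generator_eq ρ ((ρ + 1) * N), smul_mulVec]
  exact mul_nonneg (Real.exp_nonneg _) ((hasSum_exp_smul_mulVec _ t f x).nonneg fun n =>
    mul_nonneg (by positivity) (hpow n x))

/-! ### Laws of the processes -/

lemma integrable_comp {Ω E : Type*} [MeasurableSpace Ω] [Finite E] [MeasurableSpace E]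
    [MeasurableSingletonClass E] (P : Measure Ω) [IsFiniteMeasure P] {Z : Ω → E}
    (hZ : Measurable Z) (f : E → ℝ) : Integrable (fun ω => f (Z ω)) P :=
  (Integrable.of_finite (f := f) (μ := P.map Z)).comp_measurable hZ

lemma integral_comp_eq_sum {Ω E : Type*} [MeasurableSpace Ω] [Fintype E] [MeasurableSpace E]
    [MeasurableSingletonClass E] (P : Measure Ω) [IsProbabilityMeasure P] {Z : Ω → E}
    (hZ : Measurable Z) (f : E → ℝ) :
    ∫ ω, f (Z ω) ∂P = ∑ z, P.real {ω | Z ω = z} * f z := by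
  have : IsProbabilityMeasure (P.map Z) := Measure.isProbabilityMeasure_map hZ.aemeasurable
  rw [← integral_map hZ.aemeasurable (measurable_of_finite f).aestronglyMeasurable,
    integral_fintype .of_finite]
  refine Finset.sum_congr rfl fun z _ => ?_
  rw [map_measureReal_apply hZ (measurableSet_singleton z), smul_eq_mul]
  rfl

/-- The law at time `t` is that of the semigroup applied to the initial law: the finite-dimensional
distributions at the two times `0` and `t`. -/
lemma IsMarkovProcess.integral_comp {Ω E : Type*} [MeasurableSpace Ω] [Fintype E] [DecidableEq E]
    [MeasurableSpace E] [MeasurableSingletonClass E] {P : Measure Ω} [IsProbabilityMeasure P]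
    {Q : Matrix E E ℝ} {X : ℝ≥0 → Ω → E} (hX : IsMarkovProcess P Q X) (t : ℝ≥0) (f : E → ℝ) :
    ∫ ω, f (X t ω) ∂P = ∫ ω, (NormedSpace.exp ((t : ℝ) • Q) *ᵥ f) (X 0 ω) ∂P := by
  have h := integral_comp_eq_sum P ((hX.measurable 0).prodMk (hX.measurable t)) (fun z => f z.2)
  rw [integral_comp_eq_sum P (hX.measurable 0)]
  simp only at h
  rw [h, Fintype.sum_prod_type]
  refine Finset.sum_congr rfl fun x _ => ?_
  simp only [mulVec, dotProduct, Finset.mul_sum]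
  refine Finset.sum_congr rfl fun y _ => ?_
  have h1 := hX.fdd 1 ![0, t] (by simp [monotone_iff_forall_lt, Fin.forall_fin_two]) ![x, y]
  simp [Fin.forall_fin_succ] at h1
  simp only [Prod.mk.injEq, h1, mul_assoc]

/-- An upper set for the comparison of proportions is the preimage of a measurable upper set of
vectors of proportions; the layer cake formula extends the stochastic order to monotone functions. -/
lemma StochLE.integral_le {Ω Ω' : Type*} [MeasurableSpace Ω] [MeasurableSpace Ω']
    {P : Measure Ω} [IsProbabilityMeasure P] {P' : Measure Ω'} [IsProbabilityMeasure P']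
    {X : Ω → Config N K} {Y : Ω' → Config N K} (hX : Measurable X) (hY : Measurable Y)
    (h : StochLE P P' (fun ω => proportion (X ω)) (fun ω => proportion (Y ω)))
    {f : Config N K → ℝ} (hf : PropMono f) (hf0 : 0 ≤ f) :
    ∫ ω, f (X ω) ∂P ≤ ∫ ω, f (Y ω) ∂P' := by
  have hlevel (s : ℝ) : P {ω | s < f (X ω)} ≤ P' {ω | s < f (Y ω)} := by
    let A : Set (ℕ → ℝ) := ⋃ z : {z : Config N K // s < f z}, Set.Ici (proportion z.1)
    have hA : ∀ z : Config N K, proportion z ∈ A ↔ s < f z := by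
      intro z
      simp only [A, Set.mem_iUnion, Set.mem_Ici]
      exact ⟨fun ⟨w, hw⟩ => w.2.trans_le (hf _ _ hw), fun hz => ⟨⟨z, hz⟩, le_rfl⟩⟩
    have := h A (MeasurableSet.iUnion fun z => measurableSet_Ici)
      (isUpperSet_iUnion fun z => isUpperSet_Ici _)
    simpa only [Set.preimage, hA] using this
  have hfm : Measurable f := measurable_of_finite f
  have hfX : Measurable fun ω => f (X ω) := hfm.comp hX
  have hfY : Measurable fun ω => f (Y ω) := hfm.comp hY
  rw [integral_eq_lintegral_of_nonneg_ae (.of_forall fun ω => hf0 (X ω))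
      hfX.aestronglyMeasurable,
    integral_eq_lintegral_of_nonneg_ae (.of_forall fun ω => hf0 (Y ω))
      hfY.aestronglyMeasurable]
  refine ENNReal.toReal_mono ?_ ?_
  · exact (integrable_comp P' hY f).lintegral_lt_top.ne
  · rw [lintegral_eq_lintegral_meas_lt P (.of_forall fun ω => hf0 (X ω)) hfX.aemeasurable,
      lintegral_eq_lintegral_meas_lt P' (.of_forall fun ω => hf0 (Y ω)) hfY.aemeasurable]
    exact lintegral_mono fun s => hlevel s

end TwoChoice

theorem mainTheorem9 (N K : ℕ) (hN : 1 ≤ N) (ρ ρ' : ℝ) (hρ : 0 ≤ ρ) (hρρ' : ρ ≤ ρ')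
    {Ω Ω' : Type*} [MeasurableSpace Ω] [MeasurableSpace Ω']
    (P : Measure Ω) [IsProbabilityMeasure P] (P' : Measure Ω') [IsProbabilityMeasure P']
    (L : ℝ≥0 → Ω → TwoChoice.Config N K) (L' : ℝ≥0 → Ω' → TwoChoice.Config N K)
    (hL : TwoChoice.IsTwoChoiceSystem P N K ρ L)
    (hL' : TwoChoice.IsTwoChoiceSystem P' N K ρ' L')
    (h0 : TwoChoice.StochLE P P' (fun ω => TwoChoice.proportion (L 0 ω))
      (fun ω => TwoChoice.proportion (L' 0 ω))) :
    ∀ (k : ℕ) (t : ℝ≥0), 0 < t →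
      TwoChoice.StochLE P P' (fun ω => TwoChoice.proportion (L t ω) k)
        (fun ω => TwoChoice.proportion (L' t ω) k) := by
  intro k t _ A _ hA
  -- The event is `L t ∈ B`, where the indicator of `B` is monotone for the proportions.
  let B : Set (TwoChoice.Config N K) := {x | TwoChoice.proportion x k ∈ A}
  have hB : MeasurableSet B := B.toFinite.measurableSet
  let f : TwoChoice.Config N K → ℝ := B.indicator 1
  have hf0 : 0 ≤ f := fun x => Set.indicator_nonneg (fun _ _ => zero_le_one) x
  have hf : TwoChoice.PropMono f := by
    intro x y hxy
    by_cases hx : x ∈ B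
    · have hy : y ∈ B := hA (hxy k) hx
      simp [f, hx, hy]
    · exact (Set.indicator_of_notMem hx _).trans_le (hf0 y)
  have hX := hL.measurable
  have hY := hL'.measurable
  have key : ∫ ω, f (L t ω) ∂P ≤ ∫ ω, f (L' t ω) ∂P' := by
    rw [hL.integral_comp, hL'.integral_comp]
    have hg := hf.exp_generator hN hρ t.2
    have hle := hf.exp_generator_le hN hρ hρρ' t.2
    refine (h0.integral_le (hX 0) (hY 0) hg
      (TwoChoice.exp_generator_mulVec_nonneg hN hρ t.2 hf0)).trans ?_
    exact integral_mono (TwoChoice.integrable_comp P' (hY 0) _)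
      (TwoChoice.integrable_comp P' (hY 0) _) fun ω => hle _
  have hPX : ∫ ω, f (L t ω) ∂P = P.real (L t ⁻¹' B) := integral_indicator_one (hX t hB)
  have hPY : ∫ ω, f (L' t ω) ∂P' = P'.real (L' t ⁻¹' B) := integral_indicator_one (hY t hB)
  rw [hPX, hPY] at key
  exact (ENNReal.toReal_le_toReal (measure_ne_top _ _) (measure_ne_top _ _)).1 key
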